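/- Let $n,d,k\ge 0$ be integers with $2k\le d$, let $R=\mathbb{C}[x_0,\dots,x_n]$ with its usual grading, and let $R_i$ be the space of homogeneous polynomials of degree $i$ (together with $0$). For $f\in R_d$ let $J^k(f)\subset R$ be the ideal generated by all partial derivatives of $f$ of order $k$, let $M^k(f)=R/J^k(f)$ be the $k$-th order Milnor algebra, and put $h_i(M^k(f))=\dim_{\mathbb{C}}M^k(f)_i$. There is a nonempty Zariski open subset $U_{d,k}$ of the affine space $R_d$ such that the Hilbert vector $(h_i(M^k(f)))_{i\ge 0}$ is the same for all $f\in U_{d,k}$. For every such $U_{d,k}$ and every $f\in U_{d,k}$ one has $$h_i(M^k(f))=\binom{n+i}{n}\quad\text{for } 0\le i<d-k$$ and $$h_{d-k}(M^k(f))=\dim R_{d-k}-\dim R_k=\binom{n+d-k}{n}-\binom{n+k}{n}.$$ In particular, if $n\ge 1$ and $k\ge 2$ (so that $d\ge 2k\ge 4$), then the Fermat polynomial $x_0^d+\dots+x_n^d$ does not belong to $U_{d,k}$. -/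

import Mathlib

namespace HigherMilnor

open MvPolynomial

/-- The polynomial ring `R = ℂ[x₀, …, xₙ]`. -/
abbrev Poly (n : ℕ) : Type := MvPolynomial (Fin (n + 1)) ℂ

/-- `R_d`, the complex vector space of homogeneous polynomials of degree `d` (with `0`). -/
noncomputable abbrev Forms (n d : ℕ) : Submodule ℂ (Poly n) := homogeneousSubmodule (Fin (n + 1)) ℂ d

/-- The set of all partial derivatives `∂ᵏf / ∂x_{i₁} ⋯ ∂x_{iₖ}` of order exactly `k`. -/
def kthPartials {n : ℕ} (f : Poly n) : ℕ → Set (Poly n)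
  | 0 => {f}
  | k + 1 => {g | ∃ i : Fin (n + 1), ∃ h ∈ kthPartials f k, g = pderiv i h}

/-- The `k`-th order Jacobian ideal `Jᵏ(f)`: the ideal of `R` generated by the partial
derivatives of order `k` of `f`. -/
noncomputable def jacobianIdeal {n : ℕ} (k : ℕ) (f : Poly n) : Ideal (Poly n) :=
  Ideal.span (kthPartials f k)

/-- The `k`-th order Milnor algebra `Mᵏ(f) = R / Jᵏ(f)`. -/
abbrev MilnorAlgebra {n : ℕ} (k : ℕ) (f : Poly n) : Type := Poly n ⧸ jacobianIdeal k f

/-- The degree `i` part of `Mᵏ(f)`, that is, the image of `R_i`. -/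
noncomputable def milnorPart {n : ℕ} (k : ℕ) (f : Poly n) (i : ℕ) : Submodule ℂ (MilnorAlgebra k f) :=
  (Forms n i).map (Ideal.Quotient.mkₐ ℂ (jacobianIdeal k f)).toLinearMap

/-- `h_i(Mᵏ(f)) = dim Mᵏ(f)_i`; as a function of `i` this is the Hilbert vector of `Mᵏ(f)`.
(Each graded part is an image of `R_i`, hence finite dimensional.) -/
noncomputable def hilb {n : ℕ} (k : ℕ) (f : Poly n) (i : ℕ) : ℕ :=
  Module.finrank ℂ (milnorPart k f i)

/-- The exponents of the monomials of degree `d`; they index the coordinates of `R_d`. -/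
abbrev Exponents (n d : ℕ) : Type := {m : Fin (n + 1) →₀ ℕ // m.degree = d}

/-- Zariski open subsets of the affine space `R_d`, whose coordinates are the coefficients of a
form: complements of the common zero sets of families of polynomials in the coefficients. -/
def IsZariskiOpen {n d : ℕ} (U : Set (Forms n d)) : Prop :=
  ∃ S : Set (MvPolynomial (Exponents n d) ℂ),
    ∀ f : Forms n d, f ∈ U ↔ ∃ P ∈ S, eval (fun m => coeff m.1 (f : Poly n)) P ≠ 0

/-- `U` can serve as `U_{d,k}`: a nonempty Zariski open subset of `R_d` on which the Hilbert
vector of `Mᵏ(f)` is constant. -/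
def IsGenericLocus {n d : ℕ} (k : ℕ) (U : Set (Forms n d)) : Prop :=
  IsZariskiOpen U ∧ U.Nonempty ∧
    ∀ f ∈ U, ∀ g ∈ U, hilb k (f : Poly n) = hilb k (g : Poly n)

/-- The Fermat form `x₀ᵈ + ⋯ + xₙᵈ`. -/
noncomputable def fermat (n d : ℕ) : Forms n d :=
  ⟨∑ i : Fin (n + 1), X i ^ d,
    Submodule.sum_mem _ fun i _ => (mem_homogeneousSubmodule d _).2 (isHomogeneous_X_pow i d)⟩

end HigherMilnor

open HigherMilnor

namespace HigherMilnor

open MvPolynomial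

/-! ### The coefficient basis of the space of forms -/

/-! By rank–nullity `h_i` is `dim R_i` minus the dimension of the degree `i` part of `Jᵏ(f)`. That
part is spanned by the monomial multiples of `k`-th partials, vectors linear in `f`, so its
dimension is lower semicontinuous and maximal on a nonempty open set.

To make all degrees generic at once, finitely many must suffice. For `k ≥ 1` the Fermat form
supplies a degree `N` in which the Jacobian ideal is everything; the same then holds generically in
degree `N`, hence beyond it. For `k = 0` the ideal is principal and is treated directly.

In degree `d - k` the ideal is the span of the `k`-th partials. One form with independent partials
(`exists_linearIndependent_multiPderiv`, where `2k ≤ d` enters) makes them independent on a nonempty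
open set. This set meets every `U`, because a product of nonzero polynomials is nonzero. Partials of
the Fermat form span at most `n + 1` dimensions, which is too few. -/

instance finite_exponents (n d : ℕ) : Finite (Exponents n d) :=
  (Finsupp.finite_of_degree_eq d).to_subtype

noncomputable instance fintypeExponents (n d : ℕ) : Fintype (Exponents n d) := Fintype.ofFinite _

/-- A form is determined by its coefficients, which may be arbitrary. -/
noncomputable def coeffEquiv (n d : ℕ) : Forms n d ≃ₗ[ℂ] (Exponents n d → ℂ) where
  toFun f m := coeff m.1 (f : Poly n)
  map_add' f g := by ext; simp
  map_smul' c f := by ext; simp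
  invFun x := ⟨∑ m, monomial m.1 (x m), Submodule.sum_mem _ fun m _ =>
    (mem_homogeneousSubmodule d _).2 (isHomogeneous_monomial _ m.2)⟩
  left_inv f := by
    classical
    ext m
    simp only [coeff_sum, coeff_monomial]
    by_cases hm : m.degree = d
    · rw [Finset.sum_eq_single (⟨m, hm⟩ : Exponents n d)]
      · simp
      · rintro b - hb
        exact if_neg fun h => hb (Subtype.ext h)
      · simp
    · rw [((mem_homogeneousSubmodule d _).1 f.2).coeff_eq_zero hm]
      exact Finset.sum_eq_zero fun b _ => if_neg fun h => hm ((congrArg _ h).symm.trans b.2)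
  right_inv x := by
    classical
    ext m
    simp only [coeff_sum, coeff_monomial]
    rw [Finset.sum_eq_single m]
    · simp
    · rintro b - hb
      exact if_neg fun h => hb (Subtype.ext h)
    · simp

theorem coeffEquiv_apply {n d : ℕ} (f : Forms n d) (m : Exponents n d) :
    coeffEquiv n d f m = coeff m.1 (f : Poly n) := rfl

instance finite_forms (n d : ℕ) : Module.Finite ℂ (Forms n d) :=
  Module.Finite.equiv (coeffEquiv n d).symm

theorem card_exponents (n d : ℕ) : Fintype.card (Exponents n d) = (n + d).choose n := by
  classical
  have e : Exponents n d ≃ Sym (Fin (n + 1)) d :=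
    (Equiv.subtypeEquivRight fun m => by
      exact Iff.rfl).trans (Sym.equivNatSum (Fin (n + 1)) d).symm
  rw [Fintype.card_congr e, Sym.card_sym_eq_choose, Fintype.card_fin,
    show n + 1 + d - 1 = n + d by omega, Nat.choose_symm_add]

theorem finrank_forms_eq_card (n d : ℕ) :
    Module.finrank ℂ (Forms n d) = Fintype.card (Exponents n d) := by
  rw [(coeffEquiv n d).finrank_eq, Module.finrank_fintype_fun_eq_card]

theorem finrank_forms (n d : ℕ) : Module.finrank ℂ (Forms n d) = (n + d).choose n := by
  rw [finrank_forms_eq_card, card_exponents]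

/-- The value at a form of a polynomial in the coefficients. -/
noncomputable abbrev evalForm {n d : ℕ} (f : Forms n d) (P : MvPolynomial (Exponents n d) ℂ) : ℂ :=
  eval (fun m => coeff m.1 (f : Poly n)) P

theorem exists_evalForm_ne_zero {n d : ℕ} {P : MvPolynomial (Exponents n d) ℂ} (hP : P ≠ 0) :
    ∃ f : Forms n d, evalForm f P ≠ 0 := by
  by_contra! h
  refine hP (MvPolynomial.funext fun x => ?_)
  have hx : (fun m : Exponents n d => coeff m.1 (((coeffEquiv n d).symm x : Forms n d) : Poly n))
      = x := (coeffEquiv n d).apply_symm_apply x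
  simpa [evalForm, hx] using h ((coeffEquiv n d).symm x)

/-! ### Semicontinuity of ranks of linear families -/

/-- Linear functionals on forms are given by linear polynomials in the coefficients. -/
theorem exists_evalForm_eq {n d : ℕ} (φ : Forms n d →ₗ[ℂ] ℂ) :
    ∃ P : MvPolynomial (Exponents n d) ℂ, ∀ f, evalForm f P = φ f := by
  classical
  refine ⟨∑ m, C (φ ((coeffEquiv n d).symm (Pi.single m 1))) * X m, fun f => ?_⟩
  have hf : f = ∑ m, coeffEquiv n d f m • (coeffEquiv n d).symm (Pi.single m 1) := by
    apply (coeffEquiv n d).injective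
    ext j
    simp [Finset.sum_apply, Pi.single_apply]
  conv_rhs => rw [hf]
  simp [evalForm, map_sum, coeffEquiv_apply, mul_comm]

/-- Composing with a left inverse `L` of the map defined by the vectors at `f₀` gives a square
matrix with entries linear in `f`. Its determinant is the required polynomial, with value `1` at
`f₀`. -/
theorem exists_evalForm_linearIndependent {n d : ℕ} {ι W : Type*} [Finite ι] [AddCommGroup W]
    [Module ℂ W] (v : ι → Forms n d →ₗ[ℂ] W) (f₀ : Forms n d)
    (h : LinearIndependent ℂ fun j => v j f₀) :
    ∃ P : MvPolynomial (Exponents n d) ℂ, evalForm f₀ P ≠ 0 ∧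
      ∀ f, evalForm f P ≠ 0 → LinearIndependent ℂ fun j => v j f := by
  classical
  have := Fintype.ofFinite ι
  obtain ⟨L, hL⟩ := LinearMap.exists_leftInverse_of_injective
    (Fintype.linearCombination ℂ fun j => v j f₀)
    (LinearMap.ker_eq_bot.2 (linearIndependent_iff_injective_fintypeLinearCombination.1 h))
  choose M hM using fun i j => exists_evalForm_eq ((LinearMap.proj j).comp (L.comp (v i)))
  have hdet : ∀ f : Forms n d, evalForm f (Matrix.det (Matrix.of M)) =
      Matrix.det (Matrix.of fun i j => L (v i f) j) := by
    intro f
    rw [evalForm, RingHom.map_det]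
    congr 1
    ext i j
    exact hM i j f
  refine ⟨Matrix.det (Matrix.of M), ?_, fun f hf => ?_⟩
  · have : (Matrix.of fun i j => L (v i f₀) j) = (1 : Matrix ι ι ℂ) := by
      ext i j
      have := congrArg (fun T => T (Pi.single i 1) j) hL
      simpa [Fintype.linearCombination_apply_single, Matrix.one_apply, Pi.single_apply,
        eq_comm] using this
    rw [hdet, this]
    simp
  · rw [hdet] at hf
    exact (Matrix.linearIndependent_rows_of_det_ne_zero hf).of_comp L

theorem exists_evalForm_finrank_le {n d : ℕ} {ι W : Type*} [AddCommGroup W] [Module ℂ W]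
    (F : Submodule ℂ W) [Module.Finite ℂ F] (v : ι → Forms n d →ₗ[ℂ] W)
    (hv : ∀ j f, v j f ∈ F) (f₀ : Forms n d) :
    ∃ P : MvPolynomial (Exponents n d) ℂ, evalForm f₀ P ≠ 0 ∧ ∀ f, evalForm f P ≠ 0 →
      Module.finrank ℂ (Submodule.span ℂ (Set.range fun j => v j f₀)) ≤
        Module.finrank ℂ (Submodule.span ℂ (Set.range fun j => v j f)) := by
  -- A maximal independent subfamily at `f₀` stays independent nearby; it is finite because it lies
  -- in `F`, even when `ι` is infinite.
  obtain ⟨κ, a, -, hspan, hind⟩ := exists_linearIndependent' ℂ fun j => v j f₀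
  have hle : ∀ f, Submodule.span ℂ (Set.range fun j => v j f) ≤ F := fun f =>
    Submodule.span_le.2 (Set.range_subset_iff.2 fun j => hv j f)
  have hfin : ∀ f, Module.Finite ℂ (Submodule.span ℂ (Set.range fun j => v j f)) := fun f =>
    Submodule.finiteDimensional_of_le (hle f)
  have hκ : Finite κ := by
    have : LinearIndependent ℂ fun c => (⟨v (a c) f₀, hv _ _⟩ : F) :=
      LinearIndependent.of_comp F.subtype hind
    exact this.finite
  have := Fintype.ofFinite κ
  obtain ⟨P, hP₀, hP⟩ := exists_evalForm_linearIndependent (fun c => v (a c)) f₀ hind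
  refine ⟨P, hP₀, fun f hf => ?_⟩
  rw [← hspan, finrank_span_eq_card hind, ← finrank_span_eq_card (hP f hf)]
  have := hfin f
  exact Submodule.finrank_mono (Submodule.span_mono
    (Set.range_subset_iff.2 fun c => Set.mem_range_self (a c)))

/-! ### Iterated partial derivatives -/

/-- The coefficients in the basis of divided powers. -/
noncomputable def divCoeff {n : ℕ} (m : Fin (n + 1) →₀ ℕ) (f : Poly n) : ℂ :=
  (∏ i, (m i).factorial : ℕ) * coeff m f

theorem divCoeff_eq_zero_iff {n : ℕ} {m : Fin (n + 1) →₀ ℕ} {f : Poly n} :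
    divCoeff m f = 0 ↔ coeff m f = 0 := by
  simp [divCoeff, Finset.prod_eq_zero_iff, Nat.factorial_ne_zero]

theorem ext_divCoeff {n : ℕ} {f g : Poly n} (h : ∀ m, divCoeff m f = divCoeff m g) : f = g := by
  ext m
  refine mul_left_cancel₀ ?_ (h m)
  simp [Finset.prod_eq_zero_iff, Nat.factorial_ne_zero]

/-- The factorials absorb the factor `m i + 1`, so differentiation becomes a pure shift of
exponents. -/
theorem divCoeff_pderiv {n : ℕ} (m : Fin (n + 1) →₀ ℕ) (i : Fin (n + 1)) (f : Poly n) :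
    divCoeff m (pderiv i f) = divCoeff (m + Finsupp.single i 1) f := by
  classical
  have h : ∏ j, ((m + Finsupp.single i 1 : Fin (n + 1) →₀ ℕ) j).factorial = (m i + 1) * ∏ j, (m j).factorial := by
    rw [← Finset.mul_prod_erase _ _ (Finset.mem_univ i),
      ← Finset.mul_prod_erase _ (fun j => (m j).factorial) (Finset.mem_univ i)]
    have : ∏ j ∈ Finset.univ.erase i, ((m + Finsupp.single i 1 : Fin (n + 1) →₀ ℕ) j).factorial =
        ∏ j ∈ Finset.univ.erase i, (m j).factorial := by
      refine Finset.prod_congr rfl fun j hj => ?_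
      rw [Finsupp.add_apply, Finsupp.single_eq_of_ne (Finset.ne_of_mem_erase hj), add_zero]
    rw [this]
    simp [Nat.factorial_succ, mul_assoc]
  rw [divCoeff, divCoeff, h, coeff_pderiv]
  push_cast
  ring

/-- Composition of the partial derivatives in a list of variables. -/
noncomputable def listPderiv {n : ℕ} : List (Fin (n + 1)) → Poly n →ₗ[ℂ] Poly n
  | [] => LinearMap.id
  | i :: s => (pderiv i : Derivation ℂ (Poly n) (Poly n)).toLinearMap ∘ₗ listPderiv s

/-- The partial derivative `∂^α`. -/
noncomputable def multiPderiv {n : ℕ} (α : Fin (n + 1) →₀ ℕ) : Poly n →ₗ[ℂ] Poly n :=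
  listPderiv α.toMultiset.toList

theorem divCoeff_listPderiv {n : ℕ} (s : List (Fin (n + 1))) (m : Fin (n + 1) →₀ ℕ) (f : Poly n) :
    divCoeff m (listPderiv s f) = divCoeff (m + Multiset.toFinsupp (s : Multiset _)) f := by
  induction s generalizing m with
  | nil => simp [listPderiv]
  | cons i s ih =>
    rw [← Multiset.cons_coe, ← Multiset.singleton_add, Multiset.toFinsupp_add,
      Multiset.toFinsupp_singleton, ← add_assoc, ← ih, ← divCoeff_pderiv]
    rfl

theorem divCoeff_multiPderiv {n : ℕ} (α m : Fin (n + 1) →₀ ℕ) (f : Poly n) :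
    divCoeff m (multiPderiv α f) = divCoeff (m + α) f := by
  rw [multiPderiv, divCoeff_listPderiv, Multiset.coe_toList, Finsupp.toMultiset_toFinsupp]

theorem kthPartials_eq_range {n : ℕ} (f : Poly n) (k : ℕ) :
    kthPartials f k = Set.range fun α : Exponents n k => multiPderiv α.1 f := by
  classical
  induction k with
  | zero =>
    have h0 : multiPderiv 0 f = f := ext_divCoeff fun m => by simp [divCoeff_multiPderiv]
    ext g
    simp only [kthPartials, Set.mem_singleton_iff, Set.mem_range]
    constructor
    · rintro rfl
      exact ⟨⟨0, by simp⟩, h0⟩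
    · rintro ⟨⟨α, hα⟩, rfl⟩
      rw [Finsupp.degree_eq_zero_iff] at hα
      subst hα
      exact h0
  | succ k ih =>
    have hstep : ∀ i (β : Fin (n + 1) →₀ ℕ),
        pderiv i (multiPderiv β f) = multiPderiv (β + Finsupp.single i 1) f := fun i β =>
      ext_divCoeff fun m => by
        rw [divCoeff_pderiv, divCoeff_multiPderiv, divCoeff_multiPderiv, add_assoc,
          add_comm β]
    ext g
    simp only [kthPartials, ih, Set.mem_range, Set.mem_ofPred_eq]
    constructor
    · rintro ⟨i, h, ⟨β, rfl⟩, rfl⟩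
      exact ⟨⟨β.1 + Finsupp.single i 1, by simp [β.2]⟩, (hstep i β.1).symm⟩
    · rintro ⟨⟨α, hα⟩, rfl⟩
      obtain ⟨i, hi⟩ : ∃ i, α i ≠ 0 := by
        by_contra! h
        have : α = 0 := Finsupp.ext h
        simp [this] at hα
      have e : α - Finsupp.single i 1 + Finsupp.single i 1 = α :=
        tsub_add_cancel_of_le (Finsupp.single_le_iff.2 (Nat.one_le_iff_ne_zero.2 hi))
      refine ⟨i, _, ⟨⟨α - Finsupp.single i 1, ?_⟩, rfl⟩, ?_⟩
      · have := congrArg Finsupp.degree e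
        rw [map_add, hα, Finsupp.degree_single] at this
        omega
      · rw [hstep, e]

theorem multiPderiv_mem_forms {n d k : ℕ} {f : Poly n} (hf : f ∈ Forms n d)
    {α : Fin (n + 1) →₀ ℕ} (hα : α.degree = k) : multiPderiv α f ∈ Forms n (d - k) := by
  rw [mem_homogeneousSubmodule]
  intro m hm
  have h : coeff (m + α) f ≠ 0 := by
    rwa [Ne, ← divCoeff_eq_zero_iff, ← divCoeff_multiPderiv, divCoeff_eq_zero_iff]
  have := hf h
  change Finsupp.weight (fun _ => 1) _ = _ at this ⊢
  rw [← Finsupp.degree_eq_weight_one] at this ⊢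
  rw [map_add] at this
  omega

/-! ### A form with linearly independent partial derivatives -/

/-- Point evaluations on a grid separate polynomials of small degree. -/
theorem eq_zero_of_eval_grid {n k : ℕ} (c : Exponents n k → ℂ)
    (h : ∀ p : Fin (n + 1) → Fin (k + 1),
      ∑ α, c α * ∏ i, ((p i : ℕ) + 1 : ℂ) ^ α.1 i = 0) : c = 0 := by
  classical
  set F : Forms n k := (coeffEquiv n k).symm c with hF
  have hFsum : (F : Poly n) = ∑ m, monomial m.1 (c m) := rfl
  suffices hz : (F : Poly n) = 0 by
    have : F = 0 := Subtype.ext hz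
    rwa [hF, LinearEquiv.map_eq_zero_iff] at this
  let S : Finset ℂ := Finset.univ.image fun j : Fin (k + 1) => ((j : ℕ) + 1 : ℂ)
  have hS : S.card = k + 1 := by
    rw [Finset.card_image_of_injective, Finset.card_fin]
    intro a b hab
    simpa [Fin.val_inj] using hab
  refine MvPolynomial.eq_zero_of_eval_zero_at_prod_finset (F : Poly n) (fun _ => S) ?_ ?_
  · intro i
    rw [hS, Nat.lt_succ_iff]
    exact (degreeOf_le_totalDegree _ i).trans
      (((mem_homogeneousSubmodule k _).1 F.2).totalDegree_le)
  · intro x hx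
    choose p hp using fun i => Finset.mem_image.1 (hx i)
    rw [hFsum, map_sum, ← h p]
    refine Finset.sum_congr rfl fun α _ => ?_
    rw [eval_monomial, Finsupp.prod_fintype _ _ (by simp)]
    simp [fun i => (hp i).2]

theorem exists_linearIndependent_multiPderiv (n d k : ℕ) (hk : 2 * k ≤ d) :
    ∃ f : Forms n d, LinearIndependent ℂ fun α : Exponents n k => multiPderiv α.1 (f : Poly n) := by
  classical
  -- Monomials at grid points with coordinates `1, …, k + 1`: real, and positive so that powers of
  -- the first coordinate can serve as weights.
  let pt (p : Fin (n + 1) → Fin (k + 1)) (m : Fin (n + 1) →₀ ℕ) : ℂ :=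
    ∏ i, ((p i : ℕ) + 1 : ℂ) ^ m i
  have pt_add : ∀ p m m', pt p (m + m') = pt p m * pt p m' := fun p m m' => by
    simp [pt, pow_add, Finset.prod_mul_distrib]
  have conj_pt : ∀ p m, (starRingEnd ℂ) (pt p m) = pt p m := fun p m => by
    simp [pt]
  -- Up to the factor `d!`, this is the sum over the grid of the `d`-th powers of the linear forms
  -- `∑ pᵢ xᵢ`.
  let f : Forms n d := (coeffEquiv n d).symm fun m =>
    ((∏ i, (m.1 i).factorial : ℕ) : ℂ)⁻¹ * ∑ p, pt p m.1
  have hf : ∀ m : Fin (n + 1) →₀ ℕ, m.degree = d → divCoeff m (f : Poly n) = ∑ p, pt p m := by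
    intro m hm
    have : coeff m (f : Poly n) = _ :=
      congrFun ((coeffEquiv n d).apply_symm_apply _) (⟨m, hm⟩ : Exponents n d)
    rw [divCoeff, this, mul_inv_cancel_left₀]
    simp [Finset.prod_eq_zero_iff, Nat.factorial_ne_zero]
  refine ⟨f, Fintype.linearIndependent_iff.2 fun c hc => ?_⟩
  -- A relation `c` among the partials is read as a form of degree `k`, and `ev p` is its value at
  -- `p`.
  let ev (p : Fin (n + 1) → Fin (k + 1)) : ℂ := ∑ α : Exponents n k, c α * pt p α.1
  have horth : ∀ m : Fin (n + 1) →₀ ℕ, m.degree = d - k → ∑ p, ev p * pt p m = 0 := by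
    intro m hm
    have h1 : ∑ α : Exponents n k, c α * divCoeff m (multiPderiv α.1 (f : Poly n)) = 0 := by
      have := congrArg (fun g => ((∏ i, (m i).factorial : ℕ) : ℂ) * coeff m g) hc
      simp only [coeff_sum, coeff_smul, coeff_zero, mul_zero, smul_eq_mul, Finset.mul_sum] at this
      rw [← this]
      refine Finset.sum_congr rfl fun α _ => ?_
      rw [divCoeff]
      ring
    rw [← h1]
    simp only [ev, Finset.sum_mul]
    rw [Finset.sum_comm]
    refine Finset.sum_congr rfl fun α _ => ?_
    rw [divCoeff_multiPderiv, hf _ (by rw [map_add, hm, α.2]; omega), Finset.mul_sum]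
    refine Finset.sum_congr rfl fun p _ => ?_
    rw [pt_add]
    ring
  let e : Fin (n + 1) →₀ ℕ := Finsupp.single 0 (d - 2 * k)
  have hnorm : ∑ p, Complex.normSq (ev p) * ((p 0 : ℕ) + 1 : ℝ) ^ (d - 2 * k) = 0 := by
    -- Pairing with the conjugate form times `x₀^(d - 2k)`, of total degree `d - k`, turns
    -- orthogonality into a vanishing sum of nonnegative terms.
    have : ∑ α : Exponents n k, (starRingEnd ℂ) (c α) * ∑ p, ev p * pt p (α.1 + e) = 0 :=
      Finset.sum_eq_zero fun α _ => by
        rw [horth _ (by rw [map_add, α.2, Finsupp.degree_single]; omega), mul_zero]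
    have he : ∀ p, pt p e = ((p 0 : ℕ) + 1 : ℂ) ^ (d - 2 * k) := fun p => by
      simp only [pt, e]
      rw [Finset.prod_eq_single 0] <;> simp +contextual [eq_comm]
    apply Complex.ofReal_injective
    rw [Complex.ofReal_zero, ← this]
    simp only [Finset.mul_sum]
    rw [Finset.sum_comm, Complex.ofReal_sum]
    refine Finset.sum_congr rfl fun p _ => ?_
    rw [Complex.ofReal_mul, Complex.normSq_eq_conj_mul_self]
    simp only [ev, map_sum, map_mul, conj_pt, Finset.sum_mul, pt_add, he]
    push_cast
    simp only [Finset.mul_sum, Finset.sum_mul]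
    refine Finset.sum_congr rfl fun α _ => Finset.sum_congr rfl fun β _ => ?_
    ring
  have hev : ∀ p, ev p = 0 := by
    intro p
    have h0 := (Finset.sum_eq_zero_iff_of_nonneg fun p _ =>
      mul_nonneg (Complex.normSq_nonneg _) (by positivity)).1 hnorm p (Finset.mem_univ p)
    have : ((p 0 : ℕ) + 1 : ℝ) ^ (d - 2 * k) ≠ 0 := by positivity
    exact Complex.normSq_eq_zero.1 ((mul_eq_zero.1 h0).resolve_right this)
  exact congrFun (eq_zero_of_eval_grid c hev)

/-! ### Graded pieces of the Jacobian ideal -/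

/-- The degree `i` part of `Jᵏ(f)`. -/
noncomputable def jacobianPart {n : ℕ} (k : ℕ) (f : Poly n) (i : ℕ) : Submodule ℂ (Poly n) :=
  (jacobianIdeal k f).restrictScalars ℂ ⊓ Forms n i

instance finite_jacobianPart {n : ℕ} (k : ℕ) (f : Poly n) (i : ℕ) :
    Module.Finite ℂ (jacobianPart k f i) :=
  Submodule.finiteDimensional_of_le (inf_le_right : _ ≤ Forms n i)

theorem finrank_jacobianPart_le {n : ℕ} (k : ℕ) (f : Poly n) (i : ℕ) :
    Module.finrank ℂ (jacobianPart k f i) ≤ Module.finrank ℂ (Forms n i) :=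
  Submodule.finrank_mono inf_le_right

theorem hilb_add_finrank_jacobianPart {n : ℕ} (k : ℕ) (f : Poly n) (i : ℕ) :
    hilb k f i + Module.finrank ℂ (jacobianPart k f i) = Module.finrank ℂ (Forms n i) := by
  set q := (Ideal.Quotient.mkₐ ℂ (jacobianIdeal k f)).toLinearMap.domRestrict (Forms n i) with hq
  have hr : milnorPart k f i = LinearMap.range q := by
    rw [hq, LinearMap.range_domRestrict, milnorPart]
  have hker : (LinearMap.ker q).map (Forms n i).subtype = jacobianPart k f i := by
    ext g
    simp only [Submodule.mem_map, LinearMap.mem_ker, jacobianPart, Submodule.mem_inf,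
      Submodule.restrictScalars_mem]
    constructor
    · rintro ⟨g, hg, rfl⟩
      exact ⟨Ideal.Quotient.eq_zero_iff_mem.1 hg, g.2⟩
    · rintro ⟨h1, h2⟩
      exact ⟨⟨g, h2⟩, Ideal.Quotient.eq_zero_iff_mem.2 h1, rfl⟩
  rw [hilb, hr, ← hker, Submodule.finrank_map_subtype_eq]
  exact LinearMap.finrank_range_add_finrank_ker q

/-- Indices of the monomial multiples of `k`-th partial derivatives that have degree `i`. -/
abbrev PartialMultiples (n d k i : ℕ) : Type :=
  {p : (Fin (n + 1) →₀ ℕ) × Exponents n k // p.1.degree + (d - k) = i}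

/-- A monomial multiple of a `k`-th partial derivative, depending linearly on the form. -/
noncomputable def partialMultiple {n d k i : ℕ} (p : PartialMultiples n d k i) :
    Forms n d →ₗ[ℂ] Poly n :=
  LinearMap.mulLeft ℂ (monomial p.1.1 1) ∘ₗ multiPderiv p.1.2.1 ∘ₗ (Forms n d).subtype

theorem partialMultiple_apply {n d k i : ℕ} (p : PartialMultiples n d k i) (f : Forms n d) :
    partialMultiple p f = monomial p.1.1 1 * multiPderiv p.1.2.1 (f : Poly n) := rfl

theorem partialMultiple_mem_forms {n d k i : ℕ} (p : PartialMultiples n d k i) (f : Forms n d) :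
    partialMultiple p f ∈ Forms n i := by
  rw [partialMultiple_apply, mem_homogeneousSubmodule]
  have := (isHomogeneous_monomial (1 : ℂ) (rfl : p.1.1.degree = _)).mul
    ((mem_homogeneousSubmodule _ _).1 (multiPderiv_mem_forms f.2 p.1.2.2))
  rwa [p.2] at this

theorem multiPderiv_mem_jacobianIdeal {n k : ℕ} (f : Poly n) (α : Exponents n k) :
    multiPderiv α.1 f ∈ jacobianIdeal k f :=
  Ideal.subset_span (by rw [kthPartials_eq_range]; exact ⟨α, rfl⟩)

/-- Monomials span `R` over `ℂ`, so monomial multiples of the partials span the ideal; each is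
homogeneous, so projection to degree `i` keeps it or kills it. -/
theorem jacobianPart_eq_span {n d : ℕ} (k : ℕ) (f : Forms n d) (i : ℕ) :
    jacobianPart k (f : Poly n) i =
      Submodule.span ℂ (Set.range fun p : PartialMultiples n d k i => partialMultiple p f) := by
  refine le_antisymm ?_ (Submodule.span_le.2 (Set.range_subset_iff.2 fun p =>
    ⟨Ideal.mul_mem_left _ _ (multiPderiv_mem_jacobianIdeal _ _), partialMultiple_mem_forms p f⟩))
  rintro g ⟨hg, hgi⟩
  have hmon : Submodule.span ℂ (Set.range fun m : Fin (n + 1) →₀ ℕ => (monomial m 1 : Poly n)) = ⊤ := by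
    have := (basisMonomials (Fin (n + 1)) ℂ).span_eq
    rwa [coe_basisMonomials] at this
  rw [← homogeneousComponent_eq_self hgi]
  have hg' : g ∈ (Submodule.span (Poly n) (kthPartials (f : Poly n) k)).restrictScalars ℂ := hg
  rw [← Submodule.span_smul_of_span_eq_top hmon, kthPartials_eq_range] at hg'
  clear hg hgi
  induction hg' using Submodule.span_induction with
  | zero => simp
  | add x y _ _ hx hy => rw [map_add]; exact add_mem hx hy
  | smul c x _ hx => rw [map_smul]; exact Submodule.smul_mem _ c hx
  | mem x hx =>
    obtain ⟨_, ⟨m, rfl⟩, _, ⟨α, rfl⟩, rfl⟩ := hx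
    have hp := partialMultiple_mem_forms
      (⟨(m, α), rfl⟩ : PartialMultiples n d k (m.degree + (d - k))) f
    rw [partialMultiple_apply] at hp
    simp only [smul_eq_mul]
    rw [homogeneousComponent_of_mem hp]
    split_ifs with h
    · exact Submodule.subset_span ⟨⟨(m, α), h.symm⟩, rfl⟩
    · exact zero_mem _

theorem jacobianPart_eq_bot {n d k i : ℕ} (f : Forms n d) (hi : i < d - k) :
    jacobianPart k (f : Poly n) i = ⊥ := by
  have : IsEmpty (PartialMultiples n d k i) := ⟨fun p => by have := p.2; omega⟩
  rw [jacobianPart_eq_span, Set.range_eq_empty, Submodule.span_empty]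

theorem jacobianPart_initial_eq_span {n d : ℕ} (k : ℕ) (f : Forms n d) :
    jacobianPart k (f : Poly n) (d - k) = Submodule.span ℂ (kthPartials (f : Poly n) k) := by
  rw [jacobianPart_eq_span, kthPartials_eq_range]
  congr 1
  ext g
  constructor
  · rintro ⟨⟨⟨m, α⟩, h⟩, rfl⟩
    have hm : m = 0 := by
      rw [← Finsupp.degree_eq_zero_iff]
      simpa using h
    subst hm
    exact ⟨α, by simp [partialMultiple_apply]⟩
  · rintro ⟨α, rfl⟩
    exact ⟨⟨(0, α), by simp⟩, by simp [partialMultiple_apply]⟩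

/-- The rank in each degree is lower semicontinuous. -/
theorem exists_evalForm_finrank_jacobianPart_le {n d : ℕ} (k i : ℕ) (f₀ : Forms n d) :
    ∃ P : MvPolynomial (Exponents n d) ℂ, evalForm f₀ P ≠ 0 ∧ ∀ f : Forms n d, evalForm f P ≠ 0 →
      Module.finrank ℂ (jacobianPart k (f₀ : Poly n) i) ≤
        Module.finrank ℂ (jacobianPart k (f : Poly n) i) := by
  obtain ⟨P, hP₀, hP⟩ := exists_evalForm_finrank_le (Forms n i) (fun p => partialMultiple (k := k) p)
    (fun p f => partialMultiple_mem_forms p f) f₀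
  refine ⟨P, hP₀, fun f hf => ?_⟩
  rw [jacobianPart_eq_span, jacobianPart_eq_span]
  exact hP f hf

/-! ### The Fermat form -/

theorem pderiv_smul_X_pow {n : ℕ} (i : Fin (n + 1)) (c : ℂ) (e : ℕ) :
    pderiv i (c • (X i : Poly n) ^ e) = (c * e) • (X i : Poly n) ^ (e - 1) := by
  rw [Derivation.map_smul, pderiv_pow, pderiv_X_self, mul_one, mul_smul, ← nsmul_eq_mul,
    Nat.cast_smul_eq_nsmul]

theorem pderiv_fermat (n d : ℕ) (i : Fin (n + 1)) :
    pderiv i (fermat n d : Poly n) = (d : ℂ) • (X i : Poly n) ^ (d - 1) := by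
  simp only [fermat, map_sum]
  rw [Finset.sum_eq_single i]
  · simpa using pderiv_smul_X_pow i 1 d
  · intro j _ hj
    rw [pderiv_pow, pderiv_X_of_ne hj, mul_zero]
  · simp

theorem exists_smul_X_pow_mem_kthPartials_fermat {n d k : ℕ} (hk : k + 1 ≤ d) (i : Fin (n + 1)) :
    ∃ c : ℂ, c ≠ 0 ∧
      c • (X i : Poly n) ^ (d - (k + 1)) ∈ kthPartials (fermat n d : Poly n) (k + 1) := by
  induction k with
  | zero =>
    exact ⟨d, Nat.cast_ne_zero.2 (by omega), i, _, rfl, (pderiv_fermat n d i).symm⟩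
  | succ k ih =>
    obtain ⟨c, hc, hmem⟩ := ih (by omega)
    refine ⟨c * (d - (k + 1) : ℕ), mul_ne_zero hc (Nat.cast_ne_zero.2 (by omega)), i, _, hmem, ?_⟩
    rw [pderiv_smul_X_pow]
    rfl

theorem exists_eq_smul_X_pow_of_mem_kthPartials_fermat {n d k : ℕ} {g : Poly n}
    (hg : g ∈ kthPartials (fermat n d : Poly n) (k + 1)) :
    ∃ (i : Fin (n + 1)) (c : ℂ), g = c • (X i : Poly n) ^ (d - (k + 1)) := by
  induction k generalizing g with
  | zero =>
    obtain ⟨i, h, rfl, rfl⟩ := hg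
    exact ⟨i, d, pderiv_fermat n d i⟩
  | succ k ih =>
    obtain ⟨j, h, hh, rfl⟩ := hg
    obtain ⟨i, c, rfl⟩ := ih hh
    by_cases hij : i = j
    · subst hij
      exact ⟨i, _, pderiv_smul_X_pow _ _ _⟩
    · exact ⟨i, 0, by rw [Derivation.map_smul, pderiv_pow, pderiv_X_of_ne hij]; simp⟩

theorem finrank_jacobianPart_fermat_le (n d k : ℕ) :
    Module.finrank ℂ (jacobianPart (k + 1) (fermat n d : Poly n) (d - (k + 1))) ≤ n + 1 := by
  rw [jacobianPart_initial_eq_span]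
  have hle : Submodule.span ℂ (kthPartials (fermat n d : Poly n) (k + 1)) ≤
      Submodule.span ℂ (Set.range fun i : Fin (n + 1) => (X i : Poly n) ^ (d - (k + 1))) := by
    refine Submodule.span_le.2 fun g hg => ?_
    obtain ⟨i, c, rfl⟩ := exists_eq_smul_X_pow_of_mem_kthPartials_fermat hg
    exact Submodule.smul_mem _ _ (Submodule.subset_span ⟨i, rfl⟩)
  have := FiniteDimensional.span_of_finite ℂ
    (Set.finite_range fun i : Fin (n + 1) => (X i : Poly n) ^ (d - (k + 1)))
  refine (Submodule.finrank_mono hle).trans ((finrank_range_le_card _).trans ?_)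
  simp

/-- A monomial of large degree is divisible by a large power of a variable, hence lies in the
Jacobian ideal of the Fermat form. -/
theorem jacobianPart_fermat_eq_forms {n d k : ℕ} (hk : k + 1 ≤ d) :
    jacobianPart (k + 1) (fermat n d : Poly n) ((n + 1) * (d - (k + 1))) =
      Forms n ((n + 1) * (d - (k + 1))) := by
  refine inf_eq_right.2 fun g hg => ?_
  rw [Submodule.restrictScalars_mem, g.as_sum]
  refine Ideal.sum_mem _ fun m hm => ?_
  have hdeg : ∑ i, m i = ∑ _i : Fin (n + 1), (d - (k + 1)) := by
    rw [← Finsupp.degree_eq_sum, Finset.sum_const, Finset.card_fin, smul_eq_mul]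
    by_contra h
    exact mem_support_iff.1 hm (((mem_homogeneousSubmodule _ _).1 hg).coeff_eq_zero h)
  obtain ⟨i, -, hi⟩ := Finset.exists_le_of_sum_le Finset.univ_nonempty hdeg.ge
  obtain ⟨c, hc, hmem⟩ := exists_smul_X_pow_mem_kthPartials_fermat hk i
  have hX : (X i : Poly n) ^ (d - (k + 1)) ∈ jacobianIdeal (k + 1) (fermat n d : Poly n) := by
    have := Submodule.smul_of_tower_mem (jacobianIdeal (k + 1) (fermat n d : Poly n)) c⁻¹
      (Ideal.subset_span hmem)
    rwa [inv_smul_smul₀ hc] at this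
  refine Ideal.mem_of_dvd _ ?_ hX
  rw [X_pow_eq_monomial, monomial_dvd_monomial]
  exact ⟨Or.inr (Finsupp.single_le_iff.2 hi), one_dvd _⟩

/-- An ideal containing all forms of degree `N` contains all forms of larger degree. -/
theorem forms_le_of_forms_le {n N i : ℕ} {I : Ideal (Poly n)} (hNi : N ≤ i)
    (h : Forms n N ≤ I.restrictScalars ℂ) : Forms n i ≤ I.restrictScalars ℂ := by
  intro g hg
  rw [Submodule.restrictScalars_mem, g.as_sum]
  refine Ideal.sum_mem _ fun m hm => ?_
  have hdeg : m.degree = i := by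
    by_contra h
    exact mem_support_iff.1 hm (((mem_homogeneousSubmodule _ _).1 hg).coeff_eq_zero h)
  obtain ⟨m', hm', hd⟩ : ∃ m' ≤ m, m'.degree = N := by
    exact Finsupp.exists_le_degree_eq m N (by omega)
  refine Ideal.mem_of_dvd _ ?_
    (h ((mem_homogeneousSubmodule _ _).2 (isHomogeneous_monomial (1 : ℂ) hd)))
  rw [monomial_dvd_monomial]
  exact ⟨Or.inr hm', one_dvd _⟩

/-! ### The generic Hilbert vector -/

/-- For `f ≠ 0` multiplication by `f` is injective, so the monomial multiples of `f` are independent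
and their number in each degree does not depend on `f`. -/
theorem exists_isGenericLocus_zero (n d : ℕ) : ∃ U : Set (Forms n d), IsGenericLocus 0 U := by
  refine ⟨{f | f ≠ 0}, ⟨Set.range X, fun f => ?_⟩, ⟨fermat n d, ?_⟩, ?_⟩
  · constructor
    · intro hf
      by_contra! h
      refine hf ((coeffEquiv n d).map_eq_zero_iff.1 (funext fun m => ?_))
      simpa [coeffEquiv_apply] using h (X m) ⟨m, rfl⟩
    · rintro ⟨_, ⟨m, rfl⟩, hm⟩ (rfl : f = 0)
      simp at hm
  · intro h
    have := congrArg (fun g : Forms n d => eval (fun _ => (1 : ℂ)) (g : Poly n)) h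
    simp [fermat] at this
    norm_cast at this
  · have key : ∀ f : Forms n d, f ≠ 0 → ∀ i, hilb 0 (f : Poly n) i +
        Nat.card (PartialMultiples n d 0 i) = Module.finrank ℂ (Forms n i) := by
      intro f hf i
      have hid : ∀ α : Exponents n 0, multiPderiv α.1 (f : Poly n) = f := fun α => by
        have : multiPderiv α.1 (f : Poly n) ∈ kthPartials (f : Poly n) 0 := by
          rw [kthPartials_eq_range]; exact ⟨α, rfl⟩
        exact this
      have hind : LinearIndependent ℂ fun p : PartialMultiples n d 0 i => partialMultiple p f := by
        have h1 : LinearIndependent ℂ fun p : PartialMultiples n d 0 i =>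
            (monomial p.1.1 1 : Poly n) := by
          have hb := (basisMonomials (Fin (n + 1)) ℂ).linearIndependent
          rw [coe_basisMonomials] at hb
          refine hb.comp (fun p : PartialMultiples n d 0 i => p.1.1) ?_
          rintro ⟨⟨m, α, hα⟩, h⟩ ⟨⟨m', β, hβ⟩, h'⟩ (rfl : m = m')
          rw [Finsupp.degree_eq_zero_iff] at hα hβ
          subst hα hβ
          rfl
        have h2 := h1.map' (LinearMap.mulRight ℂ (f : Poly n)) (LinearMap.ker_eq_bot.2
          (mul_left_injective₀ fun h => hf (Subtype.ext h)))
        have he : (fun p : PartialMultiples n d 0 i => partialMultiple p f) =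
            LinearMap.mulRight ℂ (f : Poly n) ∘ fun p => monomial p.1.1 1 := by
          ext1 p
          rw [partialMultiple_apply, hid]
          rfl
        rw [he]
        exact h2
      rw [← hilb_add_finrank_jacobianPart 0 (f : Poly n), jacobianPart_eq_span]
      have : Finite (PartialMultiples n d 0 i) := by
        refine Set.Finite.to_subtype (((Finsupp.finite_of_degree_le i).prod
          (Set.finite_univ (α := Exponents n 0))).subset fun p hp => ⟨?_, trivial⟩)
        exact Nat.le.intro hp
      have := Fintype.ofFinite (PartialMultiples n d 0 i)
      rw [finrank_span_eq_card hind, Nat.card_eq_fintype_card]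
    intro f hf g hg
    ext i
    exact Nat.add_right_cancel ((key f hf i).trans (key g hg i).symm)

theorem exists_isGenericLocus_succ {n d k : ℕ} (hk : k + 1 ≤ d) :
    ∃ U : Set (Forms n d), IsGenericLocus (k + 1) U := by
  let r (i : ℕ) (f : Forms n d) : ℕ := Module.finrank ℂ (jacobianPart (k + 1) (f : Poly n) i)
  have hmax : ∀ i, ∃ f₀, ∀ f, r i f ≤ r i f₀ := by
    intro i
    have hbdd : BddAbove (Set.range (r i)) :=
      ⟨_, Set.forall_mem_range.2 fun f => finrank_jacobianPart_le (k + 1) (f : Poly n) i⟩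
    obtain ⟨f₀, hf₀⟩ := Nat.sSup_mem (Set.range_nonempty (r i)) hbdd
    exact ⟨f₀, fun f => hf₀ ▸ le_csSup hbdd ⟨f, rfl⟩⟩
  choose f₀ hf₀ using hmax
  choose P hP₀ hP using fun i => exists_evalForm_finrank_jacobianPart_le (k + 1) i (f₀ i)
  set N := (n + 1) * (d - (k + 1)) with hN
  let Q := ∏ i ∈ Finset.range (N + 1), P i
  have hQ : Q ≠ 0 := Finset.prod_ne_zero_iff.2 fun i _ h => hP₀ i (by simp [h])
  have hle : ∀ f, evalForm f Q ≠ 0 → ∀ i ≤ N, r i f = r i (f₀ i) := by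
    intro f hf i hi
    refine le_antisymm (hf₀ i f) (hP i f ?_)
    simp only [Q, evalForm, map_prod, Finset.prod_ne_zero_iff] at hf
    exact hf i (Finset.mem_range.2 (by omega))
  have htop : ∀ f, evalForm f Q ≠ 0 → ∀ i, N ≤ i → jacobianPart (k + 1) (f : Poly n) i = Forms n i := by
    intro f hf i hi
    have hfN : jacobianPart (k + 1) (f : Poly n) N = Forms n N := by
      refine Submodule.eq_of_le_of_finrank_le inf_le_right ?_
      -- The maximal rank in degree `N` is at least that of the Fermat form, which is all of `dim
      -- R_N`.
      have h1 := hf₀ N (fermat n d)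
      rw [← hle f hf N le_rfl] at h1
      simp only [r] at h1
      rwa [hN, jacobianPart_fermat_eq_forms hk, ← hN] at h1
    exact inf_eq_right.2 (forms_le_of_forms_le hi (inf_eq_right.1 hfN))
  refine ⟨{f | evalForm f Q ≠ 0}, ⟨{Q}, fun f => by simp⟩, exists_evalForm_ne_zero hQ, ?_⟩
  intro f hf g hg
  ext i
  have h1 := hilb_add_finrank_jacobianPart (k + 1) (f : Poly n) i
  have h2 := hilb_add_finrank_jacobianPart (k + 1) (g : Poly n) i
  rcases le_total i N with hi | hi
  · have h3 : r i f = r i g := (hle f hf i hi).trans (hle g hg i hi).symm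
    simp only [r] at h3
    omega
  · rw [htop f hf i hi] at h1
    rw [htop g hg i hi] at h2
    omega

/-- On a generic locus the `k`-th partial derivatives span a space of maximal dimension. -/
theorem IsGenericLocus.hilb_initial {n d k : ℕ} (hk : 2 * k ≤ d) {U : Set (Forms n d)}
    (hU : IsGenericLocus k U) {f : Forms n d} (hf : f ∈ U) :
    hilb k (f : Poly n) (d - k) + Module.finrank ℂ (Forms n k) =
      Module.finrank ℂ (Forms n (d - k)) := by
  obtain ⟨⟨S, hS⟩, -, hconst⟩ := hU
  obtain ⟨P, hPS, hP⟩ := (hS f).1 hf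
  obtain ⟨g, hg⟩ := exists_linearIndependent_multiPderiv n d k hk
  obtain ⟨Q, hQ, hQind⟩ := exists_evalForm_linearIndependent
    (fun α : Exponents n k => multiPderiv α.1 ∘ₗ (Forms n d).subtype) g hg
  -- `u` lies in `U` and has independent partials; constancy on `U` carries its value of `h_{d-k}`
  -- to `f`.
  obtain ⟨u, hu⟩ := exists_evalForm_ne_zero (P := P * Q)
    (mul_ne_zero (fun h => hP (by simp [h])) (fun h => hQ (by simp [h])))
  rw [evalForm, map_mul] at hu
  rw [congrFun (hconst f hf u ((hS u).2 ⟨P, hPS, left_ne_zero_of_mul hu⟩)) (d - k),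
    ← hilb_add_finrank_jacobianPart k (u : Poly n) (d - k), jacobianPart_initial_eq_span,
    kthPartials_eq_range, finrank_forms_eq_card]
  exact congrArg _ (finrank_span_eq_card (hQind u (right_ne_zero_of_mul hu))).symm

theorem IsGenericLocus.fermat_notMem {n d k : ℕ} (hk : 2 * k ≤ d) {U : Set (Forms n d)}
    (hU : IsGenericLocus k U) (hn : 1 ≤ n) (hk2 : 2 ≤ k) : fermat n d ∉ U := by
  intro hf
  obtain ⟨k, rfl⟩ : ∃ j, k = j + 1 := ⟨k - 1, by omega⟩
  have h1 := hU.hilb_initial hk hf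
  have h2 := hilb_add_finrank_jacobianPart (k + 1) (fermat n d : Poly n) (d - (k + 1))
  have h3 := finrank_jacobianPart_fermat_le n d k
  -- Membership would force `dim R_{k+1} ≤ n + 1`, whereas already `dim R_2 = (n + 2)(n + 1) / 2`
  -- exceeds `n + 1` for `n ≥ 1`.
  have h4 : (n + 2).choose n ≤ (n + (k + 1)).choose n := Nat.choose_le_choose n (by omega)
  have h5 : (n + 2).choose n * 2 = (n + 2) * (n + 1) := by
    rw [Nat.choose_symm_add, Nat.choose_two_right, Nat.div_mul_cancel]
    · rfl
    · exact (Nat.even_mul_pred_self _).two_dvd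
  rw [finrank_forms n (k + 1)] at h1
  nlinarith

end HigherMilnor

open HigherMilnor
theorem corollary3p4 (n d k : ℕ) (hk : 2 * k ≤ d) :
    (∃ U : Set (Forms n d), IsGenericLocus k U) ∧
    ∀ U : Set (Forms n d), IsGenericLocus k U →
      (∀ f ∈ U,
        (∀ i : ℕ, i < d - k → hilb k (f : Poly n) i = (n + i).choose n) ∧
        (hilb k (f : Poly n) (d - k) : ℤ)
          = (Module.finrank ℂ (Forms n (d - k)) : ℤ) - (Module.finrank ℂ (Forms n k) : ℤ) ∧
        (hilb k (f : Poly n) (d - k) : ℤ)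
          = ((n + (d - k)).choose n : ℤ) - ((n + k).choose n : ℤ)) ∧
      (1 ≤ n → 2 ≤ k → fermat n d ∉ U) := by
  constructor
  · cases k with
    | zero => exact exists_isGenericLocus_zero n d
    | succ k => exact exists_isGenericLocus_succ (by omega)
  · intro U hU
    refine ⟨fun f hf => ?_, hU.fermat_notMem hk⟩
    have h := hU.hilb_initial hk hf
    refine ⟨fun i hi => ?_, by omega, ?_⟩
    · rw [← finrank_forms, ← hilb_add_finrank_jacobianPart k (f : Poly n),
        jacobianPart_eq_bot f hi, finrank_bot, add_zero]
    · rw [← finrank_forms, ← finrank_forms]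
      omega
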